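/- **Conventions.** A topological groupoid $\mathcal G$ is a groupoid (with its objects identified with the identity arrows, forming the unit space $\mathcal G^{(0)}\subset\mathcal G$) with a locally compact Hausdorff topology for which source $s$, range $r$, inversion and composition (on the subspace $\{(\gamma,\eta): s(\gamma)=r(\eta)\}$ of $\mathcal G\times\mathcal G$) are continuous. It is *étale* if $s:\mathcal G\to\mathcal G^{(0)}$ is a local homeomorphism, and *topologically principal* if the units $x$ with trivial isotropy group $\{\gamma: s(\gamma)=r(\gamma)=x\}=\{x\}$ are dense in $\mathcal G^{(0)}$. Write $\mathcal G_x=s^{-1}(x)$. A *length function* is a map $\ell:\mathcal G\to[0,\infty)$ with $\ell(x)=0$ for $x\in\mathcal G^{(0)}$, $\ell(\gamma^{-1})=\ell(\gamma)$, and $\ell(\gamma\eta)\le\ell(\gamma)+\ell(\eta)$ whenever $\gamma\eta$ is defined. It is *proper* if every $K\subset\mathcal G\setminus\mathcal G^{(0)}$ with $\sup_K\ell<\infty$ is pre-compact in $\mathcal G$. Put $B_\ell(x,R)=\{\eta\in\mathcal G_x:\ell(x\eta^{-1})\le R\}$ for $x\in\mathcal G^{(0)}$. $\mathcal G$ has *polynomial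 growth* with respect to $\ell$ if there are real constants $C,n>0$ with $|B_\ell(x,R)|\le C(1+R)^n$ for all $x\in\mathcal G^{(0)}$ and $R>0$. A *twist* over $\mathcal G$ is a sequence $\mathcal G^{(0)}\times\mathbb T\xrightarrow{i}\mathcal E\xrightarrow{\pi}\mathcal G$ of topological groupoids ($\mathcal G^{(0)}\times\mathbb T$ being the trivial group bundle) with $i,\pi$ continuous homomorphisms restricting to homeomorphisms of unit spaces, where $\mathcal E^{(0)}$ is identified with $\mathcal G^{(0)}$ via $\pi$ and $i(x,1)$ is the unit corresponding to $x$, such that: $i$ is injective, $\pi$ is surjective and $\pi^{-1}(\mathcal G^{(0)})=i(\mathcal G^{(0)}\times\mathbb T)$; $z\cdot\varepsilon:=i(r(\varepsilon),z)\varepsilon=\varepsilon\, i(s(\varepsilon),z)$ for all $\varepsilon\in\mathcal E$, $z\in\mathbb T$; and each $\gamma\in\mathcal G$ has an open neighbourhood $U$ with a continuous section $S:U\to\mathcal E$ of $\pi$ for which $(\eta,z)\mapsto z\cdot S(\eta)$ is a homeomorphism $U\times\mathbb T\to\pi^{-1}(U)$. Let $\Sigma_c(\mathcal G,\mathcal E)$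 be the set of $f\in C_c(\mathcal E)$ with $f(z\cdot\varepsilon)=zf(\varepsilon)$ for all $z\in\mathbb T$, $\varepsilon\in\mathcal E$, and let $f^*(\varepsilon)=\overline{f(\varepsilon^{-1})}$. Fix a (not necessarily continuous) section $\rho:\mathcal G\to\mathcal E$ of $\pi$; the norms below do not depend on it. For $f\in\Sigma_c(\mathcal G,\mathcal E)$ and $t\ge0$ put $$[\lambda_x(f)\xi](\gamma)=\sum_{\eta\in\mathcal G_x}f(\rho(\gamma)\rho(\eta)^{-1})\xi(\eta)\quad(\xi\in\ell^2\mathcal G_x,\ \gamma\in\mathcal G_x),\qquad \|f\|_{C^*_r(\mathcal G,\mathcal E)}=\sup_{x\in\mathcal G^{(0)}}\|\lambda_x(f)\|_{\mathbb B(\ell^2\mathcal G_x)},$$ $$\|f\|_{\mathcal E,\ell,t,s}=\sup_{x\in\mathcal G^{(0)}}\Big(\sum_{\gamma\in\mathcal G_x}|f(\rho(\gamma))|^2(1+\ell(\gamma))^{2t}\Big)^{1/2},\qquad \|f\|_{\mathcal E,\ell,t}=\max\{\|f\|_{\mathcal E,\ell,t,s},\|f^*\|_{\mathcal E,\ell,t,s}\}.$$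 $\mathcal G$ has *$\mathcal E$-twisted rapid decay* ($\mathcal E$-(RD)) with respect to $\ell$ if there are constants $C,t\ge0$ with $\|f\|_{C^*_r(\mathcal G,\mathcal E)}\le C\|f\|_{\mathcal E,\ell,t}$ for all $f\in\Sigma_c(\mathcal G,\mathcal E)$. **Theorem.** Let $\mathcal G$ be a $\sigma$-compact, topologically principal, étale groupoid, and let $\ell$ be a continuous and proper length function on $\mathcal G$. The following are equivalent: 1. $\mathcal G$ has polynomial growth with respect to $\ell$. 2. $\mathcal G$ has $\mathcal E$-(RD) with respect to $\ell$ for all twists $\mathcal E$ over $\mathcal G$. 3. $\mathcal G$ has $\mathcal E$-(RD) with respect to $\ell$ for some twist $\mathcal E$ over $\mathcal G$. -/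

import Mathlib

open scoped ENNReal

universe u v

/-- A (small) groupoid, given by its set `G` of arrows. The objects are identified with the
identity arrows, so source and range take values in `G`; `mul a b h` is the product `ab`, which
is defined when `s(a) = r(b)`. -/
class GroupoidStr (G : Type u) where
  src : G → G
  rng : G → G
  inv : G → G
  mul : (a b : G) → src a = rng b → G
  src_src : ∀ a, src (src a) = src a
  rng_src : ∀ a, rng (src a) = src a
  src_rng : ∀ a, src (rng a) = rng a
  rng_rng : ∀ a, rng (rng a) = rng a
  src_inv : ∀ a, src (inv a) = rng a
  rng_inv : ∀ a, rng (inv a) = src a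
  src_mul : ∀ a b h, src (mul a b h) = src b
  rng_mul : ∀ a b h, rng (mul a b h) = rng a
  mul_assoc_of : ∀ a b c (hab : src a = rng b) (hbc : src b = rng c),
    mul (mul a b hab) c ((src_mul a b hab).trans hbc) =
      mul a (mul b c hbc) (hab.trans (rng_mul b c hbc).symm)
  mul_src : ∀ a, mul a (src a) (rng_src a).symm = a
  rng_mul_self : ∀ a, mul (rng a) a (src_rng a) = a
  mul_inv_eq_rng : ∀ a, mul a (inv a) (rng_inv a).symm = rng a
  inv_mul_eq_src : ∀ a, mul (inv a) a (src_inv a) = src a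

namespace GroupoidStr

/-- The unit space `G⁽⁰⁾`, as a subset of `G`. -/
def units (G : Type u) [GroupoidStr G] : Set G := Set.range (src : G → G)

variable {G : Type u} [GroupoidStr G]

/-- The source map `G → G⁽⁰⁾`. -/
def srcU (a : G) : units G := ⟨src a, a, rfl⟩

/-- The range map `G → G⁽⁰⁾`. -/
def rngU (a : G) : units G := ⟨rng a, rng a, src_rng a⟩

/-- The source fibre `G_x = {γ : s(γ) = x}`. -/
def sourceFiber (x : units G) : Set G := {a | src a = x}

theorem src_unit {a : G} (ha : a ∈ units G) : src a = a := by
  obtain ⟨b, rfl⟩ := ha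
  exact src_src b

end GroupoidStr

open GroupoidStr

/-- A topological groupoid: a groupoid with a locally compact Hausdorff topology for which the
structure maps are continuous, composition being defined on a subspace of `G × G`. -/
class TopGroupoid (G : Type u) [TopologicalSpace G] extends
    GroupoidStr G, LocallyCompactSpace G, T2Space G where
  continuous_src : Continuous (src : G → G)
  continuous_rng : Continuous (rng : G → G)
  continuous_inv : Continuous (inv : G → G)
  continuous_mul : Continuous (fun p : {p : G × G // src p.1 = rng p.2} => mul p.1.1 p.1.2 p.2)

/-- Étale: the source map `G → G⁽⁰⁾` is a local homeomorphism. -/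
def IsEtaleGroupoid (G : Type u) [TopologicalSpace G] [TopGroupoid G] : Prop :=
  IsLocalHomeomorph (srcU : G → units G)

/-- Topologically principal: the units with trivial isotropy group are dense in `G⁽⁰⁾`. -/
def IsTopologicallyPrincipal (G : Type u) [TopologicalSpace G] [TopGroupoid G] : Prop :=
  Dense {x : units G | {a : G | src a = x ∧ rng a = x} = {(x : G)}}

/-- A homomorphism of groupoids. -/
structure GrpdHom (G : Type u) (H : Type v) [GroupoidStr G] [GroupoidStr H] where
  toFun : G → H
  map_src : ∀ a, toFun (src a) = src (toFun a)
  map_rng : ∀ a, toFun (rng a) = rng (toFun a)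
  map_inv : ∀ a, toFun (inv a) = inv (toFun a)
  map_mul : ∀ a b (h : src a = rng b), toFun (mul a b h) =
    mul (toFun a) (toFun b) ((map_src a).symm.trans ((congrArg toFun h).trans (map_rng b)))

namespace GrpdHom

variable {G : Type u} {H : Type v} [GroupoidStr G] [GroupoidStr H]

instance : CoeFun (GrpdHom G H) (fun _ => G → H) := ⟨GrpdHom.toFun⟩

/-- The map induced on unit spaces. -/
def unitMap (φ : GrpdHom G H) (x : units G) : units H :=
  ⟨φ x, φ x, by rw [← φ.map_src, src_unit x.2]⟩

end GrpdHom

/-- The trivial group bundle `X × 𝕋` over `X`. -/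
def CircleBundle (X : Type u) : Type u := X × Circle

noncomputable instance (X : Type u) [TopologicalSpace X] : TopologicalSpace (CircleBundle X) :=
  inferInstanceAs (TopologicalSpace (X × Circle))

noncomputable instance (X : Type u) : GroupoidStr (CircleBundle X) where
  src p := (p.1, 1)
  rng p := (p.1, 1)
  inv p := (p.1, p.2⁻¹)
  mul p q _ := (p.1, p.2 * q.2)
  src_src _ := rfl
  rng_src _ := rfl
  src_rng _ := rfl
  rng_rng _ := rfl
  src_inv _ := rfl
  rng_inv _ := rfl
  src_mul _ _ h := h
  rng_mul _ _ _ := rfl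
  mul_assoc_of p q r _ _ := Prod.ext rfl (mul_assoc p.2 q.2 r.2)
  mul_src p := Prod.ext rfl (mul_one p.2)
  rng_mul_self p := Prod.ext rfl (one_mul p.2)
  mul_inv_eq_rng p := Prod.ext rfl (mul_inv_cancel p.2)
  inv_mul_eq_src p := Prod.ext rfl (inv_mul_cancel p.2)

/-- Continuous groupoid homomorphisms `G⁽⁰⁾ × 𝕋 → E → G` which restrict to homeomorphisms on unit
spaces. The unit space of `E` is identified with `G⁽⁰⁾` via `π`; that `i` respects this
identification is the field `pi_i_one`. -/
structure CircleSequence (G : Type u) (E : Type v) [TopologicalSpace G] [TopGroupoid G]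
    [TopologicalSpace E] [TopGroupoid E] where
  i : GrpdHom (CircleBundle (units G)) E
  π : GrpdHom E G
  continuous_i : Continuous i
  continuous_pi : Continuous π
  homeo_i : IsHomeomorph i.unitMap
  homeo_pi : IsHomeomorph π.unitMap
  pi_i_one : ∀ x : units G, π (i (x, 1)) = x

namespace CircleSequence

variable {G : Type u} {E : Type v} [TopologicalSpace G] [TopGroupoid G]
  [TopologicalSpace E] [TopGroupoid E] (T : CircleSequence G E)

theorem src_eq_of_pi {ε δ : E} (h : src (T.π ε) = src (T.π δ)) : src ε = src δ := by
  rw [← T.π.map_src, ← T.π.map_src] at h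
  exact congrArg Subtype.val (T.homeo_pi.injective
    (a₁ := srcU ε) (a₂ := srcU δ) (Subtype.ext h))

theorem i_one_rng (ε : E) : T.i (rngU (T.π ε), 1) = rng ε := by
  have h1 : T.i (rngU (T.π ε), 1) ∈ units E := ⟨_, (T.i.map_src (rngU (T.π ε), 1)).symm⟩
  have h : T.π (T.i (rngU (T.π ε), 1)) = T.π (rng ε) := by
    rw [T.pi_i_one, T.π.map_rng]; rfl
  exact congrArg Subtype.val (T.homeo_pi.injective
    (a₁ := ⟨_, h1⟩) (a₂ := rngU ε) (Subtype.ext h))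

theorem i_one_src (ε : E) : T.i (srcU (T.π ε), 1) = src ε := by
  have h1 : T.i (srcU (T.π ε), 1) ∈ units E := ⟨_, (T.i.map_src (srcU (T.π ε), 1)).symm⟩
  have h : T.π (T.i (srcU (T.π ε), 1)) = T.π (src ε) := by
    rw [T.pi_i_one, T.π.map_src]; rfl
  exact congrArg Subtype.val (T.homeo_pi.injective
    (a₁ := ⟨_, h1⟩) (a₂ := srcU ε) (Subtype.ext h))

/-- `z · ε = i(r(ε), z) ε`. -/
def lact (z : Circle) (ε : E) : E :=
  mul (T.i (rngU (T.π ε), z)) ε ((T.i.map_src (rngU (T.π ε), z)).symm.trans (T.i_one_rng ε))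

/-- `ε · z = ε i(s(ε), z)`. -/
def ract (ε : E) (z : Circle) : E :=
  mul ε (T.i (srcU (T.π ε), z))
    ((T.i_one_src ε).symm.trans (T.i.map_rng (srcU (T.π ε), z)))

end CircleSequence

/-- A twist `G⁽⁰⁾ × 𝕋 → E → G` over `G`. -/
structure Twist (G : Type u) (E : Type v) [TopologicalSpace G] [TopGroupoid G]
    [TopologicalSpace E] [TopGroupoid E] extends CircleSequence G E where
  injective_i : Function.Injective i
  exact : π ⁻¹' units G = Set.range i
  surjective_pi : Function.Surjective π
  central : ∀ (ε : E) (z : Circle), toCircleSequence.lact z ε = toCircleSequence.ract ε z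
  locally_trivial : ∀ γ : G, ∃ U : Set G, IsOpen U ∧ γ ∈ U ∧ ∃ S : U → E, Continuous S ∧
    (∀ η : U, π (S η) = η) ∧
    ∃ Φ : U × Circle ≃ₜ (π ⁻¹' U), ∀ (η : U) (z : Circle),
      (Φ (η, z) : E) = toCircleSequence.lact z (S η)

/-- A length function on a groupoid. -/
structure LengthFunction (G : Type u) [GroupoidStr G] where
  toFun : G → ℝ
  nonneg : ∀ a, 0 ≤ toFun a
  map_unit : ∀ x ∈ units G, toFun x = 0
  map_inv : ∀ a, toFun (inv a) = toFun a
  map_mul_le : ∀ a b h, toFun (mul a b h) ≤ toFun a + toFun b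

namespace LengthFunction

variable {G : Type u} [GroupoidStr G]

instance : CoeFun (LengthFunction G) (fun _ => G → ℝ) := ⟨LengthFunction.toFun⟩

/-- Proper: each subset of `G \ G⁽⁰⁾` on which the length is bounded is pre-compact in `G`. -/
def IsProper [TopologicalSpace G] (l : LengthFunction G) : Prop :=
  ∀ K : Set G, K ⊆ (units G)ᶜ → BddAbove (l '' K) → IsCompact (closure K)

/-- The closed ball `B(γ, R) = {η : s(η) = s(γ), l(γ η⁻¹) ≤ R}` in the source fibre of `γ`. -/
def ball (l : LengthFunction G) (γ : G) (R : ℝ) : Set G :=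
  {η | ∃ h : src γ = src η, l (mul γ (inv η) (h.trans (rng_inv η).symm)) ≤ R}

/-- Polynomial growth of `G` with respect to `l`. -/
def HasPolynomialGrowth (l : LengthFunction G) : Prop :=
  ∃ C > (0 : ℝ), ∃ n > (0 : ℝ), ∀ x ∈ units G, ∀ R > (0 : ℝ),
    (l.ball x R).Finite ∧ ((l.ball x R).ncard : ℝ) ≤ C * (1 + R) ^ n

end LengthFunction

namespace Twist

variable {G : Type u} {E : Type v} [TopologicalSpace G] [TopGroupoid G]
  [TopologicalSpace E] [TopGroupoid E] (T : Twist G E)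

/-- `Σ_c(G, E)`: the continuous compactly supported functions `f` on `E` such that
`f(z · ε) = z f(ε)`. -/
def sigmaC : Set (E → ℂ) :=
  {f | Continuous f ∧ HasCompactSupport f ∧ ∀ (z : Circle) (ε : E), f (T.lact z ε) = z * f ε}

/-- The involution `f*(ε) = conj (f(ε⁻¹))`. -/
def involution (f : E → ℂ) : E → ℂ := fun ε => (starRingEnd ℂ) (f (inv ε))

/-- A fixed, not necessarily continuous, section `G → E` of `π`. -/
noncomputable def rho : G → E := Function.surjInv T.surjective_pi

theorem pi_rho (γ : G) : T.π (T.rho γ) = γ := Function.surjInv_eq T.surjective_pi γ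

theorem src_rho_eq {x : units G} (γ η : sourceFiber x) :
    src (T.rho γ) = rng (inv (T.rho η)) := by
  rw [rng_inv]
  refine T.src_eq_of_pi ?_
  rw [T.pi_rho, T.pi_rho]
  exact Eq.trans γ.2 (Eq.symm η.2)

/-- The regular representation at `x`:
`[λ_x(f) ξ](γ) = ∑_{η ∈ G_x} f(ρ(γ) ρ(η)⁻¹) ξ(η)` for `ξ ∈ ℓ²(G_x)` and `γ ∈ G_x`. -/
noncomputable def regRep (f : E → ℂ) (x : units G)
    (ξ : lp (fun _ : sourceFiber x => ℂ) 2) (γ : sourceFiber x) : ℂ :=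
  ∑' η : sourceFiber x, f (mul (T.rho γ) (inv (T.rho η)) (T.src_rho_eq γ η)) * ξ η

/-- The operator norm of `λ_x(f)` on `ℓ²(G_x)`, as an element of `[0, ∞]`. -/
noncomputable def regRepNorm (f : E → ℂ) (x : units G) : ℝ≥0∞ :=
  ⨆ (ξ : lp (fun _ : sourceFiber x => ℂ) 2) (_ : ‖ξ‖ ≤ 1),
    (∑' γ : sourceFiber x, ‖T.regRep f x ξ γ‖ₑ ^ 2) ^ (1 / 2 : ℝ)

/-- The norm of `f` in the reduced twisted groupoid C*-algebra. -/
noncomputable def reducedNorm (f : E → ℂ) : ℝ≥0∞ := ⨆ x : units G, T.regRepNorm f x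

/-- `(∑_{γ ∈ G_x} |f(ρ(γ))|² (1 + l(γ))^{2t})^{1/2}`. -/
noncomputable def fiberNorm (l : LengthFunction G) (t : ℝ) (f : E → ℂ) (x : units G) : ℝ≥0∞ :=
  (∑' γ : sourceFiber x,
    ENNReal.ofReal (‖f (T.rho γ)‖ ^ 2 * (1 + l γ) ^ (2 * t))) ^ (1 / 2 : ℝ)

/-- The supremum of the fibre norms over all units. -/
noncomputable def sourceNorm (l : LengthFunction G) (t : ℝ) (f : E → ℂ) : ℝ≥0∞ :=
  ⨆ x : units G, T.fiberNorm l t f x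

/-- The weighted norm, symmetrized with respect to the involution. -/
noncomputable def decayNorm (l : LengthFunction G) (t : ℝ) (f : E → ℂ) : ℝ≥0∞ :=
  max (T.sourceNorm l t f) (T.sourceNorm l t (involution f))

/-- `E`-twisted rapid decay of `G` with respect to the length function `l`. -/
def HasRapidDecay (l : LengthFunction G) : Prop :=
  ∃ C ≥ (0 : ℝ), ∃ t ≥ (0 : ℝ), ∀ f ∈ T.sigmaC,
    T.reducedNorm f ≤ ENNReal.ofReal C * T.decayNorm l t f

end Twist

/-! Growth implies decay for every twist because a twist only contributes phases. If growth has
exponent `n`, then `(1 + l) ^ (-(n + 2))` has uniformly bounded sums over source fibres, so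
Cauchy–Schwarz bounds the ℓ¹ norms of `f` and `f*` on fibres by the decay norm
(`tsum_enorm_le_fiberNorm_mul`). These ℓ¹ norms bound the columns and rows of the matrix of
`λ_x(f)`, and the Schur test gives its operator norm (`regRepNorm_le`). The trivial twist provides
one twist with decay.

Conversely, let `F` be a finite set of arrows of length at most `R` with source `x`, where `x` has
trivial isotropy. Distinct elements of `F` have distinct ranges, so the quotients `γη⁻¹` can be
separated by their sources and ranges. Bumps near them add up to an `f` for which `λ_x(f)` contains
an all-ones block of size `|F|`, of norm `|F|`, while `f` and `f*` have at most `|F|` nonzero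
values, up to phase, on each source fibre (`exists_test_function`). Rapid decay then reads `|F| ≤ C
(|F| (2R + 2) ^ (2t)) ^ (1/2)`, a polynomial bound on `|F|`. Étaleness and density carry it to all
units (`exists_finset_of_dense`). -/

namespace GroupoidStr

/-! ### Groupoid algebra and source fibres. -/

variable {G : Type u} [GroupoidStr G]

theorem rng_unit {a : G} (ha : a ∈ units G) : rng a = a := by
  obtain ⟨b, rfl⟩ := ha
  exact rng_src b

theorem src_mem_units (a : G) : src a ∈ units G := ⟨a, rfl⟩

theorem rng_mem_units (a : G) : rng a ∈ units G := ⟨rng a, src_rng a⟩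

theorem mul_congr {a a' b b' : G} (ha : a = a') (hb : b = b') (h : src a = rng b) :
    mul a b h = mul a' b' (by rw [← ha, ← hb]; exact h) := by
  subst ha hb
  rfl

theorem mul_of_right_unit {a b : G} (hb : b ∈ units G) (h : src a = rng b) : mul a b h = a := by
  have hb' : b = src a := by rw [h, rng_unit hb]
  subst hb'
  exact mul_src a

theorem mul_of_left_unit {a b : G} (ha : a ∈ units G) (h : src a = rng b) : mul a b h = b := by
  have ha' : a = rng b := by rw [← h, src_unit ha]
  subst ha'
  exact rng_mul_self b

theorem inv_unit {a : G} (ha : a ∈ units G) : inv a = a := by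
  have h := inv_mul_eq_src a
  rwa [mul_of_right_unit ha, src_unit ha] at h

theorem mul_div_self {a b : G} (h : src a = rng b) (h' : src (mul a b h) = rng (inv b)) :
    mul (mul a b h) (inv b) h' = a := by
  rw [mul_assoc_of a b (inv b) h (rng_inv b).symm]
  exact (mul_congr rfl (mul_inv_eq_rng b) _).trans (mul_of_right_unit (rng_mem_units b) _)

theorem div_mul_self {a b : G} (h : src a = rng (inv b))
    (h' : src (mul a (inv b) h) = rng b) : mul (mul a (inv b) h) b h' = a := by
  rw [mul_assoc_of a (inv b) b h (src_inv b)]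
  exact (mul_congr rfl (inv_mul_eq_src b) _).trans (mul_of_right_unit (src_mem_units b) _)

theorem eq_of_mul_eq_mul_right {a a' b : G} {h : src a = rng b} {h' : src a' = rng b}
    (e : mul a b h = mul a' b h') : a = a' := by
  rw [← mul_div_self h (by rw [src_mul, rng_inv]), mul_congr e rfl, mul_div_self]

theorem inv_inv_eq (a : G) : inv (inv a) = a := by
  refine eq_of_mul_eq_mul_right (b := inv a) (h := by rw [src_inv]) (h' := by rw [rng_inv]) ?_
  rw [inv_mul_eq_src, mul_inv_eq_rng, src_inv]

theorem inv_injective : Function.Injective (inv : G → G) :=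
  Function.LeftInverse.injective inv_inv_eq

theorem mul_mul_mul_inv {a b c d : G} (hab : src a = rng b) (hcd : src c = rng d)
    (hbc : src b = rng c) (h : src (mul a b hab) = rng (mul c d hcd)) :
    mul (mul a b hab) (mul c d hcd) h =
      mul a (mul (mul b c hbc) d (by rw [src_mul, hcd])) (by rw [rng_mul, rng_mul, hab]) := by
  rw [mul_assoc_of a b (mul c d hcd) hab (by rw [rng_mul, hbc])]
  exact mul_congr rfl (mul_assoc_of b c d hbc hcd).symm _

theorem inv_mul_inv {a b : G} (h : src a = rng (inv b)) :
    inv (mul a (inv b) h) = mul b (inv a) (by rw [rng_inv, h, rng_inv]) := by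
  have hba : src b = rng (inv a) := by rw [rng_inv, h, rng_inv]
  refine eq_of_mul_eq_mul_right (b := mul a (inv b) h) (h := by rw [src_inv])
    (h' := by rw [src_mul, src_inv, rng_mul]) ?_
  rw [inv_mul_eq_src, mul_mul_mul_inv hba h (src_inv a), src_mul, src_inv]
  refine ((mul_congr rfl ((mul_congr (inv_mul_eq_src a) rfl _).trans
    (mul_of_left_unit (src_mem_units a) _)) _).trans (mul_inv_eq_rng b)).symm

theorem src_eq_of_mem {x : units G} (γ η : sourceFiber x) : src (γ : G) = rng (inv (η : G)) := by
  rw [rng_inv]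
  exact Eq.trans γ.2 η.2.symm

/-- Right division by `η`, as a map from the source fibre of `η` to that of `rng η`. -/
def divFiber {x : units G} (η γ : sourceFiber x) : sourceFiber (rngU (η : G)) :=
  ⟨mul γ (inv (η : G)) (src_eq_of_mem γ η), by
    change src _ = rng (η : G)
    rw [src_mul, src_inv]⟩

/-- Right cancellation. It lets a column sum of the matrix of `λ_x(f)` be bounded by a sum over one
whole source fibre. -/
theorem divFiber_injective {x : units G} (η : sourceFiber x) :
    Function.Injective (divFiber η) := fun _ _ h =>
  Subtype.ext (eq_of_mul_eq_mul_right (congrArg Subtype.val h))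

/-- The arrow `η⁻¹γ` lies in the isotropy group at `x`, so it is the unit `x`. -/
theorem eq_of_rng_eq_of_trivial_isotropy {x : units G}
    (hx : {a : G | src a = x ∧ rng a = x} = {(x : G)}) {γ η : G}
    (hγ : src γ = x) (hη : src η = x) (h : rng γ = rng η) : γ = η := by
  have hc : src (inv η) = rng γ := by rw [src_inv, h]
  have hm : mul (inv η) γ hc = x := by
    have : mul (inv η) γ hc ∈ {a : G | src a = x ∧ rng a = x} :=
      ⟨by rw [src_mul, hγ], by rw [rng_mul, rng_inv, hη]⟩
    rwa [hx] at this
  refine inv_injective (eq_of_mul_eq_mul_right (b := γ) (h := src_inv γ) (h' := hc) ?_)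
  rw [inv_mul_eq_src, hm, hγ]

end GroupoidStr

namespace LengthFunction

variable {G : Type u} [GroupoidStr G] (l : LengthFunction G)

theorem mem_ball_unit {x : G} (hx : x ∈ units G) {R : ℝ} {η : G} :
    η ∈ l.ball x R ↔ src η = x ∧ l η ≤ R := by
  constructor
  · rintro ⟨h, hR⟩
    rw [mul_of_left_unit hx, l.map_inv] at hR
    exact ⟨by rw [← h, src_unit hx], hR⟩
  · rintro ⟨h, hR⟩
    refine ⟨by rw [src_unit hx, h], ?_⟩
    rw [mul_of_left_unit hx, l.map_inv]
    exact hR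

theorem map_div_le {a b : G} (h : src a = rng (inv b)) :
    l (mul a (inv b) h) ≤ l a + l b := by
  simpa only [l.map_inv] using l.map_mul_le a (inv b) h

end LengthFunction

/-! ### Fibres of a twist are circle orbits. -/

namespace Twist

variable {G : Type u} {E : Type v} [TopologicalSpace G] [TopGroupoid G]
  [TopologicalSpace E] [TopGroupoid E] (T : Twist G E)

/-- By exactness the left side is a unit, hence equal to its own source, which is the image of `(x,
1)`. -/
theorem pi_i (x : units G) (z : Circle) : T.π (T.i (x, z)) = x := by
  have h : T.π (T.i (x, z)) ∈ units G := by
    change T.i (x, z) ∈ T.π ⁻¹' units G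
    rw [T.exact]
    exact ⟨_, rfl⟩
  rw [← src_unit h, ← T.π.map_src]
  exact (congrArg T.π (T.i.map_src (x, z)).symm).trans (T.pi_i_one x)

theorem pi_lact (z : Circle) (ε : E) : T.π (T.lact z ε) = T.π ε := by
  rw [CircleSequence.lact, T.π.map_mul]
  refine mul_of_left_unit ?_ _
  rw [T.pi_i]
  exact Subtype.property _

theorem lact_lact (w z : Circle) (ε : E) : T.lact w (T.lact z ε) = T.lact (w * z) ε := by
  have hr : rngU (T.π (T.lact z ε)) = rngU (T.π ε) := by rw [T.pi_lact]
  have h1 : src (T.i (rngU (T.π ε), w)) = rng (T.i (rngU (T.π ε), z)) :=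
    (T.i.map_src (rngU (T.π ε), w)).symm.trans (T.i.map_rng (rngU (T.π ε), z))
  have h2 : src (T.i (rngU (T.π ε), z)) = rng ε :=
    (T.i.map_src (rngU (T.π ε), z)).symm.trans (T.i_one_rng ε)
  have h3 := mul_assoc_of _ _ ε h1 h2
  have h4 : mul (T.i (rngU (T.π ε), w)) (T.i (rngU (T.π ε), z)) h1 = T.i (rngU (T.π ε), w * z) :=
    (T.i.map_mul (rngU (T.π ε), w) (rngU (T.π ε), z) rfl).symm
  rw [mul_congr h4 rfl] at h3
  rw [CircleSequence.lact]
  refine (mul_congr (by rw [hr]) rfl _).trans h3.symm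

/-- The quotient `εδ⁻¹` lies over a unit, so exactness puts it in the image of `i`; applying `π`
identifies the base point. -/
theorem exists_lact_eq_of_pi_eq {ε δ : E} (h : T.π ε = T.π δ) : ∃ z : Circle, T.lact z δ = ε := by
  have hs : src ε = rng (inv δ) := by
    rw [rng_inv]
    exact T.src_eq_of_pi (by rw [h])
  have hu : mul ε (inv δ) hs ∈ T.π ⁻¹' units G := by
    change T.π _ ∈ units G
    rw [T.π.map_mul, mul_congr h (T.π.map_inv δ), mul_inv_eq_rng]
    exact rng_mem_units _
  rw [T.exact] at hu
  obtain ⟨⟨y, z⟩, hy⟩ := hu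
  have hy' : y = rngU (T.π δ) := by
    refine Subtype.ext ?_
    rw [← T.pi_i y z]
    rw [hy, T.π.map_mul, mul_congr h (T.π.map_inv δ), mul_inv_eq_rng]
    rfl
  subst hy'
  refine ⟨z, ?_⟩
  rw [CircleSequence.lact, mul_congr hy rfl, div_mul_self]

theorem norm_eq_of_pi_eq {f : E → ℂ} (hf : f ∈ T.sigmaC) {ε δ : E} (h : T.π ε = T.π δ) :
    ‖f ε‖ = ‖f δ‖ := by
  obtain ⟨z, rfl⟩ := T.exists_lact_eq_of_pi_eq h
  rw [hf.2.2, norm_mul, Circle.norm_coe, one_mul]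

theorem norm_involution_eq_of_pi_eq {f : E → ℂ} (hf : f ∈ T.sigmaC) {ε δ : E}
    (h : T.π ε = T.π δ) : ‖involution f ε‖ = ‖involution f δ‖ := by
  simp only [involution, RCLike.norm_conj]
  exact T.norm_eq_of_pi_eq hf (by rw [T.π.map_inv, T.π.map_inv, h])

/-- The section `ρ` need not be multiplicative, but `ρ(γ)ρ(η)⁻¹` and `ρ(γη⁻¹)` lie over the same
arrow and so differ by a phase only. -/
theorem pi_div_rho {x : units G} (γ η : sourceFiber x) :
    T.π (mul (T.rho γ) (inv (T.rho η)) (T.src_rho_eq γ η)) =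
      mul (γ : G) (inv (η : G)) (src_eq_of_mem γ η) := by
  rw [T.π.map_mul]
  exact mul_congr (T.pi_rho γ) (by rw [T.π.map_inv, T.pi_rho]) _

end Twist

/-! ### Cauchy–Schwarz and the Schur test in `[0, ∞]`. -/

namespace ENNReal

theorem tsum_mul_le_sqrt_mul_sqrt {ι : Type*} (f g : ι → ℝ≥0∞) :
    ∑' i, f i * g i ≤ (∑' i, f i ^ 2) ^ (1 / 2 : ℝ) * (∑' i, g i ^ 2) ^ (1 / 2 : ℝ) := by
  rw [ENNReal.tsum_eq_iSup_sum]
  refine iSup_le fun s => ?_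
  refine (ENNReal.inner_le_Lp_mul_Lq s f g Real.HolderConjugate.two_two).trans ?_
  simp only [ENNReal.rpow_ofNat]
  gcongr <;> exact ENNReal.sum_le_tsum s

theorem sqrt_sq (a : ℝ≥0∞) : (a ^ (1 / 2 : ℝ)) ^ 2 = a := by
  rw [← ENNReal.rpow_natCast, ← ENNReal.rpow_mul]
  norm_num

theorem sq_sqrt (a : ℝ≥0∞) : (a ^ 2) ^ (1 / 2 : ℝ) = a := by
  rw [← ENNReal.rpow_natCast, ← ENNReal.rpow_mul]
  norm_num

/-- Cauchy–Schwarz for the splitting `a ξ = a ^ (1/2) · (a ^ (1/2) ξ)`. -/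
theorem tsum_mul_sq_le {ι : Type*} (a ξ : ι → ℝ≥0∞) :
    (∑' i, a i * ξ i) ^ 2 ≤ (∑' i, a i) * ∑' i, a i * ξ i ^ 2 := by
  have h := ENNReal.tsum_mul_le_sqrt_mul_sqrt (fun i => a i ^ (1 / 2 : ℝ))
    (fun i => a i ^ (1 / 2 : ℝ) * ξ i)
  simp only [mul_pow, sqrt_sq, ← mul_assoc, ← sq] at h
  calc _ ≤ _ := pow_le_pow_left' h 2
    _ = _ := by rw [mul_pow, sqrt_sq, sqrt_sq]

/-- The Schur test for nonnegative kernels. -/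
theorem schur_test {ι κ : Type*} (a : κ → ι → ℝ≥0∞) (ξ : ι → ℝ≥0∞) {A B : ℝ≥0∞}
    (hA : ∀ k, ∑' i, a k i ≤ A) (hB : ∀ i, ∑' k, a k i ≤ B) :
    ∑' k, (∑' i, a k i * ξ i) ^ 2 ≤ A * B * ∑' i, ξ i ^ 2 := by
  calc ∑' k, (∑' i, a k i * ξ i) ^ 2 ≤ ∑' k, A * ∑' i, a k i * ξ i ^ 2 :=
        ENNReal.tsum_le_tsum fun k => (tsum_mul_sq_le _ _).trans (by gcongr; exact hA k)
    _ = A * ∑' i, (∑' k, a k i) * ξ i ^ 2 := by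
        rw [ENNReal.tsum_mul_left, ENNReal.tsum_comm]
        simp only [ENNReal.tsum_mul_right]
    _ ≤ A * ∑' i, B * ξ i ^ 2 := by
        gcongr with i
        exact hB i
    _ = A * B * ∑' i, ξ i ^ 2 := by rw [ENNReal.tsum_mul_left, mul_assoc]

end ENNReal

theorem lp.tsum_enorm_sq_le_one {ι : Type*} (ξ : lp (fun _ : ι => ℂ) 2) (hξ : ‖ξ‖ ≤ 1) :
    ∑' i, ‖ξ i‖ₑ ^ 2 ≤ 1 := by
  have hs := (lp.memℓp ξ).summable (by norm_num : 0 < (2 : ℝ≥0∞).toReal)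
  have hn := lp.norm_rpow_eq_tsum (by norm_num : 0 < (2 : ℝ≥0∞).toReal) ξ
  simp only [ENNReal.toReal_ofNat, Real.rpow_ofNat] at hs hn
  have : ∀ i, ‖ξ i‖ₑ ^ 2 = ENNReal.ofReal (‖ξ i‖ ^ 2) := fun i => by
    rw [ENNReal.ofReal_pow (norm_nonneg _), ofReal_norm]
  simp only [this]
  rw [← ENNReal.ofReal_tsum_of_nonneg (fun _ => by positivity) hs, ← hn, ENNReal.ofReal_le_one]
  exact pow_le_one₀ (norm_nonneg _) hξ

theorem ENNReal.tsum_const_le_of_ncard {ι : Type*} {s : Set ι} (hs : s.Finite) {b : ℝ}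
    (hb : (s.ncard : ℝ) ≤ b) (c : ℝ≥0∞) : ∑' _ : s, c ≤ ENNReal.ofReal b * c := by
  rw [ENNReal.tsum_const]
  gcongr
  rw [ENat.card_coe_set_eq, ← hs.cast_ncard_eq]
  simpa using ENNReal.ofReal_le_ofReal hb

/-! ### Polynomial growth implies rapid decay. -/

namespace LengthFunction

variable {G : Type u} [GroupoidStr G] {l : LengthFunction G}

/-- Under polynomial growth some negative power of `1 + l` is summable along the source fibres,
uniformly in the fibre. -/
theorem HasPolynomialGrowth.exists_tsum_rpow_le (h : l.HasPolynomialGrowth) :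
    ∃ t ≥ (0 : ℝ), ∃ K ≥ (0 : ℝ), ∀ x : units G,
      ∑' γ : sourceFiber x, ENNReal.ofReal ((1 + l γ) ^ (-(2 * t))) ≤ ENNReal.ofReal K := by
  obtain ⟨C, hC, n, hn, hb⟩ := h
  have hsum : Summable fun k : ℕ => C * 2 ^ n * (1 / ((k : ℝ) + 1) ^ 2) :=
    Summable.mul_left _ (by
      simpa using (summable_nat_add_iff 1).2 (Real.summable_one_div_nat_pow.2 one_lt_two))
  -- With `2t = n + 2`, the shell `k ≤ l < k + 1` has at most `C (k + 2) ^ n ≤ C 2 ^ n (k + 1) ^ n`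
  -- elements, each of weight at most `(k + 1) ^ (-(n + 2))`. This leaves a convergent series.
  refine ⟨(n + 2) / 2, by positivity, ∑' k : ℕ, C * 2 ^ n * (1 / ((k : ℝ) + 1) ^ 2),
    tsum_nonneg fun k => by positivity, fun x => ?_⟩
  rw [ENNReal.ofReal_tsum_of_nonneg (fun k => by positivity) hsum,
    ← ENNReal.tsum_fiberwise _ (fun γ : sourceFiber x => ⌊l γ⌋₊)]
  refine ENNReal.tsum_le_tsum fun k => ?_
  set s : Set (sourceFiber x) := (fun γ : sourceFiber x => ⌊l γ⌋₊) ⁻¹' {k} with hs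
  have hk : (0 : ℝ) < k + 1 := by positivity
  obtain ⟨hfin, hcard⟩ := hb x x.2 (k + 1) hk
  have hsub : Subtype.val '' s ⊆ l.ball x (k + 1) := by
    rintro _ ⟨γ, hγ, rfl⟩
    refine (l.mem_ball_unit x.2).2 ⟨γ.2, ?_⟩
    have := Nat.lt_floor_add_one (l γ)
    rw [show ⌊l γ⌋₊ = k from hγ] at this
    exact this.le
  have hsfin : s.Finite := Set.Finite.of_finite_image (hfin.subset hsub)
    Subtype.val_injective.injOn
  have hscard : (s.ncard : ℝ) ≤ C * (1 + (k + 1)) ^ n := by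
    refine le_trans ?_ hcard
    rw [← Set.ncard_image_of_injective s Subtype.val_injective]
    exact_mod_cast Set.ncard_le_ncard hsub hfin
  calc ∑' γ : s, ENNReal.ofReal ((1 + l γ) ^ (-(2 * ((n + 2) / 2))))
      ≤ ∑' _ : s, ENNReal.ofReal ((k + 1 : ℝ) ^ (-(n + 2))) := by
        refine ENNReal.tsum_le_tsum fun γ => ENNReal.ofReal_le_ofReal ?_
        rw [show -(2 * ((n + 2) / 2)) = -(n + 2) by ring]
        refine Real.rpow_le_rpow_of_nonpos hk ?_ (by linarith)
        have := Nat.floor_le (l.nonneg γ)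
        rw [show ⌊l γ⌋₊ = k from γ.2] at this
        linarith
    _ ≤ ENNReal.ofReal (C * (1 + (k + 1)) ^ n) * ENNReal.ofReal ((k + 1 : ℝ) ^ (-(n + 2))) :=
        ENNReal.tsum_const_le_of_ncard hsfin hscard _
    _ ≤ ENNReal.ofReal (C * 2 ^ n * (1 / ((k : ℝ) + 1) ^ 2)) := by
        rw [← ENNReal.ofReal_mul (by positivity)]
        refine ENNReal.ofReal_le_ofReal ?_
        have h1 : (1 + (k + 1) : ℝ) ^ n ≤ 2 ^ n * (k + 1 : ℝ) ^ n := by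
          rw [← Real.mul_rpow (by positivity) (by positivity)]
          refine Real.rpow_le_rpow (by positivity) ?_ hn.le
          linarith [(Nat.cast_nonneg k : (0 : ℝ) ≤ k)]
        have h2 : (k + 1 : ℝ) ^ n * (k + 1 : ℝ) ^ (-(n + 2)) = 1 / ((k : ℝ) + 1) ^ 2 := by
          rw [← Real.rpow_add hk, show n + -(n + 2) = -2 by ring, Real.rpow_neg hk.le,
            Real.rpow_ofNat, one_div]
        calc C * (1 + (k + 1) : ℝ) ^ n * (k + 1 : ℝ) ^ (-(n + 2))
            ≤ C * (2 ^ n * (k + 1 : ℝ) ^ n) * (k + 1 : ℝ) ^ (-(n + 2)) := by gcongr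
          _ = C * 2 ^ n * ((k + 1 : ℝ) ^ n * (k + 1 : ℝ) ^ (-(n + 2))) := by ring
          _ = _ := by rw [h2]

end LengthFunction

namespace Twist

variable {G : Type u} {E : Type v} [TopologicalSpace G] [TopGroupoid G]
  [TopologicalSpace E] [TopGroupoid E] (T : Twist G E)

/-- Cauchy–Schwarz after inserting `(1 + l) ^ t · (1 + l) ^ (-t) = 1`. -/
theorem tsum_enorm_le_fiberNorm_mul (l : LengthFunction G) (t : ℝ) (g : E → ℂ) (x : units G) :
    ∑' γ : sourceFiber x, ‖g (T.rho γ)‖ₑ ≤ T.fiberNorm l t g x *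
      (∑' γ : sourceFiber x, ENNReal.ofReal ((1 + l γ) ^ (-(2 * t)))) ^ (1 / 2 : ℝ) := by
  have hpos : ∀ γ : G, 0 < 1 + l γ := fun γ => by linarith [l.nonneg γ]
  have h := ENNReal.tsum_mul_le_sqrt_mul_sqrt
    (fun γ : sourceFiber x => ENNReal.ofReal (‖g (T.rho γ)‖ * (1 + l γ) ^ t))
    (fun γ : sourceFiber x => ENNReal.ofReal ((1 + l γ) ^ (-t)))
  have e1 : ∀ γ : sourceFiber x, ENNReal.ofReal (‖g (T.rho γ)‖ * (1 + l γ) ^ t) *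
      ENNReal.ofReal ((1 + l γ) ^ (-t)) = ‖g (T.rho γ)‖ₑ := fun γ => by
    have := hpos γ
    rw [← ENNReal.ofReal_mul (by positivity), mul_assoc, ← Real.rpow_add this, add_neg_cancel,
      Real.rpow_zero, mul_one, ofReal_norm]
  have e2 : ∀ γ : sourceFiber x, ENNReal.ofReal (‖g (T.rho γ)‖ * (1 + l γ) ^ t) ^ 2 =
      ENNReal.ofReal (‖g (T.rho γ)‖ ^ 2 * (1 + l γ) ^ (2 * t)) := fun γ => by
    have := hpos γ
    rw [← ENNReal.ofReal_pow (by positivity), mul_pow, mul_comm 2 t, Real.rpow_mul this.le,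
      Real.rpow_ofNat]
  have e3 : ∀ γ : sourceFiber x, ENNReal.ofReal ((1 + l γ) ^ (-t)) ^ 2 =
      ENNReal.ofReal ((1 + l γ) ^ (-(2 * t))) := fun γ => by
    have := hpos γ
    rw [← ENNReal.ofReal_pow (by positivity), show -(2 * t) = -t * 2 by ring,
      Real.rpow_mul this.le, Real.rpow_ofNat]
  simpa only [e1, e2, e3, fiberNorm] using h

/-- Up to phases, column `η` of the matrix of `λ_x(f)` lists values of `f` on the fibre over `rng
η`, and row `γ` lists values of `f*` on the fibre over `rng γ`. The Schur test therefore needs both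
ℓ¹ bounds. -/
theorem regRepNorm_le {f : E → ℂ} (hf : f ∈ T.sigmaC) {A : ℝ≥0∞}
    (hA : ∀ x : units G, ∑' γ : sourceFiber x, ‖f (T.rho γ)‖ₑ ≤ A)
    (hA' : ∀ x : units G, ∑' γ : sourceFiber x, ‖involution f (T.rho γ)‖ₑ ≤ A) (x : units G) :
    T.regRepNorm f x ≤ A := by
  refine iSup₂_le fun ξ hξ => ?_
  set a : sourceFiber x → sourceFiber x → ℝ≥0∞ := fun γ η =>
    ‖f (mul (T.rho γ) (inv (T.rho η)) (T.src_rho_eq γ η))‖ₑ with ha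
  have h1 : ∀ γ η, a γ η = ‖f (T.rho (divFiber η γ))‖ₑ := fun γ η => by
    change ‖f (mul (T.rho γ) (inv (T.rho η)) (T.src_rho_eq γ η))‖ₑ = _
    rw [← ofReal_norm, ← ofReal_norm,
      T.norm_eq_of_pi_eq hf ((T.pi_div_rho γ η).trans (T.pi_rho _).symm)]
    rfl
  have h2 : ∀ γ η, a γ η = ‖involution f (T.rho (divFiber γ η))‖ₑ := fun γ η => by
    have e : ‖involution f (T.rho (divFiber γ η))‖ =
        ‖involution f (mul (T.rho η) (inv (T.rho γ)) (T.src_rho_eq η γ))‖ :=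
      T.norm_involution_eq_of_pi_eq hf ((T.pi_rho _).trans (T.pi_div_rho η γ).symm)
    rw [← ofReal_norm, e, involution, inv_mul_inv, RCLike.norm_conj, ofReal_norm]
  have hr : ∀ γ, ∑' η, a γ η ≤ A := fun γ => by
    simp only [h2]
    exact (ENNReal.tsum_comp_le_tsum_of_injective (divFiber_injective γ)
      (fun δ => ‖involution f (T.rho δ)‖ₑ)).trans (hA' _)
  have hc : ∀ η, ∑' γ, a γ η ≤ A := fun η => by
    simp only [h1]
    exact (ENNReal.tsum_comp_le_tsum_of_injective (divFiber_injective η)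
      (fun δ => ‖f (T.rho δ)‖ₑ)).trans (hA _)
  have key : ∑' γ : sourceFiber x, ‖T.regRep f x ξ γ‖ₑ ^ 2 ≤ A ^ 2 := by
    calc ∑' γ : sourceFiber x, ‖T.regRep f x ξ γ‖ₑ ^ 2
        ≤ ∑' γ : sourceFiber x, (∑' η, a γ η * ‖ξ η‖ₑ) ^ 2 := by
          refine ENNReal.tsum_le_tsum fun γ => pow_le_pow_left' ?_ 2
          refine enorm_tsum_le_tsum_enorm.trans_eq ?_
          simp only [enorm_mul, ha]
      _ ≤ A * A * ∑' η, ‖ξ η‖ₑ ^ 2 := ENNReal.schur_test a _ hr hc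
      _ ≤ A * A * 1 := by gcongr; exact lp.tsum_enorm_sq_le_one ξ hξ
      _ = A ^ 2 := by rw [mul_one, sq]
  exact (ENNReal.rpow_le_rpow key (by norm_num)).trans_eq (ENNReal.sq_sqrt A)

theorem hasRapidDecay_of_hasPolynomialGrowth {l : LengthFunction G}
    (h : l.HasPolynomialGrowth) : T.HasRapidDecay l := by
  obtain ⟨t, ht, K, hK, hb⟩ := h.exists_tsum_rpow_le
  refine ⟨K ^ (1 / 2 : ℝ), by positivity, t, ht, fun f hf => iSup_le fun x => ?_⟩
  have hS : ∀ (g : E → ℂ) (y : units G), T.sourceNorm l t g ≤ T.decayNorm l t f →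
      ∑' γ : sourceFiber y, ‖g (T.rho γ)‖ₑ ≤
        ENNReal.ofReal (K ^ (1 / 2 : ℝ)) * T.decayNorm l t f := fun g y hg => by
    refine (T.tsum_enorm_le_fiberNorm_mul l t g y).trans ?_
    rw [mul_comm, ← ENNReal.ofReal_rpow_of_nonneg hK (by norm_num)]
    gcongr
    · exact hb y
    · exact (le_iSup (T.fiberNorm l t g) y).trans hg
  exact T.regRepNorm_le hf (fun y => hS f y (le_max_left _ _))
    (fun y => hS _ y (le_max_right _ _)) x

end Twist

/-! ### The trivial twist. -/

section TrivialTwist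

variable (G : Type u) [TopologicalSpace G] [TopGroupoid G]

/-- The product groupoid `G × 𝕋`. -/
noncomputable instance prodCircleGroupoidStr : GroupoidStr (G × Circle) where
  src p := (src p.1, 1)
  rng p := (rng p.1, 1)
  inv p := (inv p.1, p.2⁻¹)
  mul p q h := (mul p.1 q.1 (congrArg Prod.fst h), p.2 * q.2)
  src_src p := Prod.ext (src_src p.1) rfl
  rng_src p := Prod.ext (rng_src p.1) rfl
  src_rng p := Prod.ext (src_rng p.1) rfl
  rng_rng p := Prod.ext (rng_rng p.1) rfl
  src_inv p := Prod.ext (src_inv p.1) rfl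
  rng_inv p := Prod.ext (rng_inv p.1) rfl
  src_mul p q _ := Prod.ext (src_mul p.1 q.1 _) rfl
  rng_mul p q _ := Prod.ext (rng_mul p.1 q.1 _) rfl
  mul_assoc_of p q r hp hq := Prod.ext
    (mul_assoc_of p.1 q.1 r.1 (congrArg Prod.fst hp) (congrArg Prod.fst hq))
    (mul_assoc p.2 q.2 r.2)
  mul_src p := Prod.ext (mul_src p.1) (mul_one p.2)
  rng_mul_self p := Prod.ext (rng_mul_self p.1) (one_mul p.2)
  mul_inv_eq_rng p := Prod.ext (mul_inv_eq_rng p.1) (mul_inv_cancel p.2)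
  inv_mul_eq_src p := Prod.ext (inv_mul_eq_src p.1) (inv_mul_cancel p.2)

noncomputable instance prodCircleTopGroupoid : TopGroupoid (G × Circle) where
  continuous_src := (TopGroupoid.continuous_src.comp continuous_fst).prodMk continuous_const
  continuous_rng := (TopGroupoid.continuous_rng.comp continuous_fst).prodMk continuous_const
  continuous_inv := (TopGroupoid.continuous_inv.comp continuous_fst).prodMk continuous_snd.inv
  continuous_mul := by
    refine Continuous.prodMk ?_ ?_
    · exact TopGroupoid.continuous_mul.comp
        (f := fun p : {p : (G × Circle) × (G × Circle) // src p.1 = rng p.2} =>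
          (⟨(p.1.1.1, p.1.2.1), congrArg Prod.fst p.2⟩ : {p : G × G // src p.1 = rng p.2}))
        (by fun_prop)
    · fun_prop

theorem mem_units_prodCircle {p : G × Circle} :
    p ∈ units (G × Circle) ↔ p.1 ∈ units G ∧ p.2 = 1 := by
  constructor
  · rintro ⟨q, rfl⟩
    exact ⟨⟨q.1, rfl⟩, rfl⟩
  · rintro ⟨⟨a, ha⟩, h⟩
    exact ⟨(a, 1), Prod.ext ha h.symm⟩

theorem continuous_circleBundle_val :
    Continuous (fun p : CircleBundle (units G) => ((p.1 : G), p.2)) :=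
  (continuous_subtype_val.comp continuous_fst).prodMk continuous_snd

/-- The sequence `G⁽⁰⁾ × 𝕋 → G × 𝕋 → G`. -/
noncomputable def trivialCircleSequence : CircleSequence G (G × Circle) where
  i := { toFun := fun p => ((p.1 : G), p.2)
         map_src := fun p => Prod.ext (src_unit p.1.2).symm rfl
         map_rng := fun p => Prod.ext (rng_unit p.1.2).symm rfl
         map_inv := fun p => Prod.ext (inv_unit p.1.2).symm rfl
         map_mul := fun p q h => Prod.ext (mul_of_right_unit q.1.2 _).symm rfl }
  π := { toFun := Prod.fst
         map_src := fun _ => rfl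
         map_rng := fun _ => rfl
         map_inv := fun _ => rfl
         map_mul := fun _ _ _ => rfl }
  continuous_i := continuous_circleBundle_val G
  continuous_pi := continuous_fst
  homeo_i := by
    rw [isHomeomorph_iff_exists_inverse]
    refine ⟨?_, fun p => ⟨(⟨p.1.1, ((mem_units_prodCircle G).1 p.2).1⟩, 1),
      ⟨(⟨p.1.1, ((mem_units_prodCircle G).1 p.2).1⟩, 1), rfl⟩⟩,
      ?_, ?_, ?_⟩
    · exact Continuous.subtype_mk ((continuous_circleBundle_val G).comp
        (continuous_subtype_val (p := (· ∈ units (CircleBundle (units G)))))) _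
    · rintro ⟨_, p, rfl⟩
      rfl
    · rintro ⟨p, hp⟩
      exact Subtype.ext (Prod.ext rfl ((mem_units_prodCircle G).1 hp).2.symm)
    · exact Continuous.subtype_mk (Continuous.prodMk (Continuous.subtype_mk
        (continuous_fst.comp continuous_subtype_val) _) continuous_const) _
  homeo_pi := by
    rw [isHomeomorph_iff_exists_inverse]
    refine ⟨?_, fun x => ⟨((x : G), 1), (mem_units_prodCircle G).2 ⟨x.2, rfl⟩⟩, ?_, ?_, ?_⟩
    · exact Continuous.subtype_mk (continuous_fst.comp continuous_subtype_val) _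
    · rintro ⟨p, hp⟩
      exact Subtype.ext (Prod.ext rfl ((mem_units_prodCircle G).1 hp).2.symm)
    · exact fun x => Subtype.ext rfl
    · exact Continuous.subtype_mk (continuous_subtype_val.prodMk continuous_const) _
  pi_i_one _ := rfl

theorem trivialCircleSequence_lact (z : Circle) (ε : G × Circle) :
    (trivialCircleSequence G).lact z ε = (ε.1, z * ε.2) :=
  Prod.ext (rng_mul_self ε.1) rfl

theorem trivialCircleSequence_ract (ε : G × Circle) (z : Circle) :
    (trivialCircleSequence G).ract ε z = (ε.1, ε.2 * z) :=
  Prod.ext (mul_src ε.1) rfl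

/-- The trivial twist `G × 𝕋` over `G`. -/
noncomputable def trivialTwist : Twist G (G × Circle) where
  toCircleSequence := trivialCircleSequence G
  injective_i _ _ h := Prod.ext (Subtype.ext (congrArg (Prod.fst : G × Circle → G) h))
    (congrArg (Prod.snd : G × Circle → Circle) h)
  exact := by
    ext p
    constructor
    · exact fun hp => ⟨(⟨p.1, hp⟩, p.2), rfl⟩
    · rintro ⟨q, rfl⟩
      exact q.1.2
  surjective_pi γ := ⟨(γ, 1), rfl⟩
  central ε z := by
    rw [trivialCircleSequence_lact, trivialCircleSequence_ract, mul_comm]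
  locally_trivial γ := by
    refine ⟨Set.univ, isOpen_univ, trivial, fun η => (η, 1), by fun_prop, fun _ => rfl,
      { toFun := fun p => ⟨(p.1, p.2), trivial⟩
        invFun := fun ε => (⟨ε.1.1, trivial⟩, ε.1.2)
        left_inv := fun _ => rfl
        right_inv := fun _ => rfl
        continuous_toFun := by fun_prop
        continuous_invFun := by fun_prop }, fun η z => ?_⟩
    rw [trivialCircleSequence_lact, mul_one]
    rfl

end TrivialTwist

/-! ### Equivariant bump functions and bisections. -/

namespace Twist

variable {G : Type u} {E : Type v} [TopologicalSpace G] [TopGroupoid G]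
  [TopologicalSpace E] [TopGroupoid E] (T : Twist G E)

theorem zero_mem_sigmaC : (0 : E → ℂ) ∈ T.sigmaC :=
  ⟨continuous_const, HasCompactSupport.zero, fun _ _ => by simp⟩

theorem add_mem_sigmaC {f g : E → ℂ} (hf : f ∈ T.sigmaC) (hg : g ∈ T.sigmaC) :
    f + g ∈ T.sigmaC :=
  ⟨hf.1.add hg.1, hf.2.1.add hg.2.1, fun z ε => by
    simp only [Pi.add_apply, hf.2.2, hg.2.2, mul_add]⟩

theorem sum_mem_sigmaC {ι : Type*} (s : Finset ι) {f : ι → E → ℂ} (hf : ∀ i, f i ∈ T.sigmaC) :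
    ∑ i ∈ s, f i ∈ T.sigmaC := by
  classical
  induction s using Finset.induction_on with
  | empty => simpa using T.zero_mem_sigmaC
  | insert a s ha ih => rw [Finset.sum_insert ha]; exact T.add_mem_sigmaC (hf a) ih

theorem smul_mem_sigmaC (c : ℂ) {f : E → ℂ} (hf : f ∈ T.sigmaC) : c • f ∈ T.sigmaC :=
  ⟨hf.1.const_smul c, hf.2.1.smul_left (f := fun _ => c), fun z ε => by
    simp only [Pi.smul_apply, hf.2.2, smul_eq_mul]; ring⟩

/-- Equivariant bump functions: for `ε₀` over a point of an open set `W ⊆ G` there is an element of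
`Σ_c(G, E)` supported over `W`, bounded by `1`, with value `1` at `ε₀`. -/
theorem exists_bump (ε₀ : E) {W : Set G} (hW : IsOpen W) (hε : T.π ε₀ ∈ W) :
    ∃ f ∈ T.sigmaC, f ε₀ = 1 ∧ (∀ ε, ‖f ε‖ ≤ 1) ∧ ∀ ε, f ε ≠ 0 → T.π ε ∈ W := by
  classical
  obtain ⟨U, hU, hδ, S, -, hS, Φ, hΦ⟩ := T.locally_trivial (T.π ε₀)
  obtain ⟨K, hK, hδK, hKW⟩ := exists_compact_subset (hU.inter hW) ⟨hδ, hε⟩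
  obtain ⟨φ, hφ1, hφ0, -, hφ⟩ := exists_continuous_one_zero_of_isCompact
    (isCompact_singleton (x := T.π ε₀)) isOpen_interior.isClosed_compl
    (Set.disjoint_singleton_left.2 (Set.notMem_compl_iff.2 hδK))
  have hφK : ∀ γ, γ ∉ K → φ γ = 0 := fun γ hγ => hφ0 (fun h => hγ (interior_subset h))
  have hUo : IsOpen (T.π ⁻¹' U) := hU.preimage T.continuous_pi
  -- In the local trivialisation this is `z · S(η) ↦ φ(η) z`, which is equivariant. As `φ` vanishes
  -- off the compact set `K ⊆ U ∩ W`, extension by zero is continuous, and the support lies in the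
  -- compact image of `K × 𝕋`.
  set f : E → ℂ := fun ε => if h : T.π ε ∈ U then
    (φ (T.π ε) : ℂ) * ((Φ.symm ⟨ε, h⟩).2 : ℂ) else 0 with hf
  have hfU : ∀ (ε : E) (h : T.π ε ∈ U),
      f ε = (φ (T.π ε) : ℂ) * ((Φ.symm ⟨ε, h⟩).2 : ℂ) := fun ε h => by simp only [hf, dif_pos h]
  have hfK : ∀ ε, T.π ε ∉ K → f ε = 0 := fun ε h => by
    by_cases hu : T.π ε ∈ U
    · rw [hfU ε hu, hφK _ h]; simp
    · simp only [hf, dif_neg hu]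
  have hsymm : ∀ (η : U) (z : Circle) (h : T.π (T.lact z (S η)) ∈ U),
      Φ.symm ⟨T.lact z (S η), h⟩ = (η, z) := fun η z h => by
    rw [Homeomorph.symm_apply_eq]
    exact Subtype.ext (hΦ η z).symm
  have hcont : Continuous f := by
    refine continuous_iff_continuousAt.2 fun ε => ?_
    by_cases h : T.π ε ∈ U
    · have : ContinuousOn f (T.π ⁻¹' U) := by
        rw [continuousOn_iff_continuous_domRestrict]
        have e : (T.π ⁻¹' U).domRestrict f = fun ε : T.π ⁻¹' U =>
            (φ (T.π ε) : ℂ) * ((Φ.symm ε).2 : ℂ) :=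
          funext fun ε => hfU ε ε.2
        rw [e]
        have := T.continuous_pi
        fun_prop
      exact this.continuousAt (hUo.mem_nhds h)
    · have hn : (T.π ⁻¹' K)ᶜ ∈ nhds ε :=
        (hK.isClosed.preimage T.continuous_pi).isOpen_compl.mem_nhds fun hk => h (hKW hk).1
      refine (continuousAt_const (y := (0 : ℂ))).congr ?_
      filter_upwards [hn] with ε' hε' using (hfK ε' hε').symm
  have hcomp : HasCompactSupport f := by
    have hKU : IsCompact ((Subtype.val : U → G) ⁻¹' K) :=
      Topology.IsInducing.subtypeVal.isCompact_preimage' hK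
        (by rw [Subtype.range_coe]; exact fun _ hk => (hKW hk).1)
    refine HasCompactSupport.intro ((hKU.prod (isCompact_univ (X := Circle))).image
      (continuous_subtype_val.comp Φ.continuous)) fun ε hε => hfK ε fun hk => hε ?_
    have hu : T.π ε ∈ U := (hKW hk).1
    obtain ⟨z, hz⟩ := T.exists_lact_eq_of_pi_eq (ε := ε) (δ := S ⟨T.π ε, hu⟩) (hS ⟨T.π ε, hu⟩).symm
    exact ⟨(⟨T.π ε, hu⟩, z), ⟨hk, trivial⟩, (hΦ _ _).trans hz⟩
  have hequiv : ∀ (w : Circle) (ε : E), f (T.lact w ε) = w * f ε := fun w ε => by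
    by_cases hu : T.π ε ∈ U
    · obtain ⟨z, hz⟩ := T.exists_lact_eq_of_pi_eq (ε := ε) (δ := S ⟨T.π ε, hu⟩) (hS ⟨T.π ε, hu⟩).symm
      have h1 : T.lact w ε = T.lact (w * z) (S ⟨T.π ε, hu⟩) := by rw [← T.lact_lact, hz]
      have hv : ∀ z' : Circle, f (T.lact z' (S ⟨T.π ε, hu⟩)) = φ (T.π ε) * (z' : ℂ) :=
        fun z' => by
          rw [hfU _ (by rw [T.pi_lact, hS]; exact hu), hsymm, T.pi_lact, hS]
      rw [h1, hv, (congrArg f hz).symm.trans (hv z), Circle.coe_mul]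
      ring
    · rw [hfK _ (fun h => hu (by rw [T.pi_lact] at h; exact (hKW h).1)),
        hfK _ (fun h => hu (hKW h).1), mul_zero]
  have hnorm : ∀ ε, ‖f ε‖ ≤ 1 := fun ε => by
    by_cases hu : T.π ε ∈ U
    · rw [hfU ε hu, norm_mul, Circle.norm_coe, mul_one, Complex.norm_real, Real.norm_eq_abs,
        abs_of_nonneg (hφ _).1]
      exact (hφ _).2
    · simp [hf, dif_neg hu]
  have hone : ‖f ε₀‖ = 1 := by
    rw [hfU ε₀ hδ, norm_mul, Circle.norm_coe, mul_one, Complex.norm_real, hφ1 rfl]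
    simp
  have hmem : f ∈ T.sigmaC := ⟨hcont, hcomp, hequiv⟩
  have hne : f ε₀ ≠ 0 := fun h => by simp [h] at hone
  -- The value `f ε₀` is a phase, so dividing by it keeps the bound `1`.
  refine ⟨(f ε₀)⁻¹ • f, T.smul_mem_sigmaC _ hmem, inv_mul_cancel₀ hne, fun ε => ?_,
    fun ε hε => ?_⟩
  · rw [Pi.smul_apply, norm_smul, norm_inv, hone, inv_one, one_mul]
    exact hnorm ε
  · by_contra hW'
    exact hε (by rw [Pi.smul_apply, hfK ε (fun h => hW' (hKW h).2), smul_zero])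

end Twist

/-- The source is injective near `δ` and near `δ⁻¹`; inversion turns the latter into injectivity of
the range near `δ`. -/
theorem IsEtaleGroupoid.exists_bisection {G : Type u} [TopologicalSpace G] [TopGroupoid G]
    (hG : IsEtaleGroupoid G) (δ : G) :
    ∃ O : Set G, IsOpen O ∧ δ ∈ O ∧ Set.InjOn (src : G → G) O ∧ Set.InjOn (rng : G → G) O := by
  have hsrc : ∀ δ : G, ∃ O : Set G, IsOpen O ∧ δ ∈ O ∧ Set.InjOn (src : G → G) O := fun δ => by
    obtain ⟨e, he, hee⟩ := hG δ
    refine ⟨e.source, e.open_source, he, fun a ha b hb hab => e.injOn ha hb ?_⟩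
    rw [← hee]
    exact Subtype.ext hab
  obtain ⟨O, hO, hδ, hi⟩ := hsrc δ
  obtain ⟨O', hO', hδ', hi'⟩ := hsrc (inv δ)
  refine ⟨O ∩ inv ⁻¹' O', hO.inter (hO'.preimage TopGroupoid.continuous_inv), ⟨hδ, hδ'⟩,
    hi.mono Set.inter_subset_left, fun a ha b hb hab => inv_injective (hi' ha.2 hb.2 ?_)⟩
  rw [src_inv, src_inv, hab]

/-! ### Test functions and lower bounds at units with trivial isotropy. -/

namespace Twist

variable {G : Type u} {E : Type v} [TopologicalSpace G] [TopGroupoid G]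
  [TopologicalSpace E] [TopGroupoid E] (T : Twist G E)

/-- A bound on the fibre norm of a function bounded by `1` whose support in the fibre injects into
a finite set. -/
theorem fiberNorm_le_of_support {l : LengthFunction G} {t b : ℝ} (ht : 0 ≤ t) {g : E → ℂ}
    {y : units G} {ι : Type*} (F : Finset ι) (r : ι → G → Prop)
    (hg : ∀ ε, ‖g ε‖ ≤ 1) (hb : ∀ α : G, g (T.rho α) ≠ 0 → 1 + l α ≤ b)
    (hr : ∀ α : G, g (T.rho α) ≠ 0 → ∃ i ∈ F, r i α)
    (hinj : ∀ i ∈ F, ∀ α ∈ sourceFiber y, ∀ β ∈ sourceFiber y, r i α → r i β → α = β) :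
    T.fiberNorm l t g y ≤ ENNReal.ofReal (F.card * b ^ (2 * t)) ^ (1 / 2 : ℝ) := by
  refine ENNReal.rpow_le_rpow ?_ (by norm_num)
  set s : Set (sourceFiber y) := {α | g (T.rho α) ≠ 0} with hs
  -- Each arrow in the support gets a label in `F`; labels are injective, so the support in the
  -- fibre has at most `|F|` points.
  choose φ hφF hφr using hr
  set ψ : s → F := fun α => ⟨φ α α.2, hφF α α.2⟩ with hψ
  have hψi : Function.Injective ψ := fun α β hab => by
    refine Subtype.ext (Subtype.ext (hinj (φ α α.2) (hφF α α.2) α α.1.2 β β.1.2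
      (hφr α α.2) ?_))
    rw [show φ α α.2 = φ β β.2 from congrArg Subtype.val hab]
    exact hφr β β.2
  have hsfin : s.Finite := @Set.toFinite _ s (Finite.of_injective ψ hψi)
  have hcard : (s.ncard : ℝ) ≤ F.card := by
    have := Nat.card_le_card_of_injective ψ hψi
    rw [Nat.card_coe_set_eq, Nat.card_eq_fintype_card, Fintype.card_coe] at this
    exact_mod_cast this
  have hsupp : Function.support (fun γ : sourceFiber y =>
      ENNReal.ofReal (‖g (T.rho γ)‖ ^ 2 * (1 + l γ) ^ (2 * t))) ⊆ s := fun γ hγ h0 => by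
    refine hγ ?_
    simp [h0]
  rw [← tsum_subtype_eq_of_support_subset hsupp, ENNReal.ofReal_mul (by positivity)]
  refine le_trans (ENNReal.tsum_le_tsum fun γ => ENNReal.ofReal_le_ofReal ?_)
    (ENNReal.tsum_const_le_of_ncard hsfin hcard (ENNReal.ofReal (b ^ (2 * t))))
  have h1 : 0 ≤ 1 + l (γ : sourceFiber y) := by linarith [l.nonneg (γ : sourceFiber y)]
  calc ‖g (T.rho (γ : sourceFiber y))‖ ^ 2 * (1 + l (γ : sourceFiber y)) ^ (2 * t)
      ≤ 1 * b ^ (2 * t) := by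
        gcongr
        · exact pow_le_one₀ (norm_nonneg _) (hg _)
        · exact hb _ γ.2
    _ = _ := one_mul _

/-- Near a finite subset of the fibre over a unit with trivial isotropy there is an element of
`Σ_c(G, E)` which is `1` on all quotients of the finite set and has small weighted norm. -/
theorem exists_test_function (hG : IsEtaleGroupoid G) {l : LengthFunction G} (hl : Continuous l)
    {x : units G} (hx : {a : G | src a = x ∧ rng a = x} = {(x : G)})
    (F : Finset (sourceFiber x)) {R : ℝ} (hR : ∀ γ ∈ F, l γ ≤ R) :
    ∃ f ∈ T.sigmaC, (∀ γ ∈ F, ∀ η ∈ F,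
        f (mul (T.rho γ) (inv (T.rho η)) (T.src_rho_eq γ η)) = 1) ∧
      ∀ t ≥ (0 : ℝ), T.decayNorm l t f ≤
        ENNReal.ofReal (F.card * (2 * R + 2) ^ (2 * t)) ^ (1 / 2 : ℝ) := by
  classical
  -- Disjoint neighbourhoods of the ranges. Trivial isotropy makes the range injective on `F`, so a
  -- point of some `V` names one element of `F`.
  obtain ⟨V, hV, hVd⟩ := ((F.finite_toSet).image
    (fun γ : sourceFiber x => rng (γ : G))).t2_separation
  have hVeq : ∀ γ ∈ F, ∀ η ∈ F, ∀ y, y ∈ V (rng (γ : G)) → y ∈ V (rng (η : G)) → γ = η :=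
    fun γ hγ η hη y hyγ hyη => by
      have h : rng (γ : G) = rng (η : G) := by
        by_contra hne
        exact Set.disjoint_left.1 (hVd ⟨γ, hγ, rfl⟩ ⟨η, hη, rfl⟩ hne) hyγ hyη
      exact Subtype.ext (eq_of_rng_eq_of_trivial_isotropy hx γ.2 η.2 h)
  -- A bisection around `γη⁻¹` whose sources name `η` and whose ranges name `γ`; hence these sets
  -- are disjoint for distinct pairs from `F`. The extra `1` makes the length bound an open
  -- condition.
  have hW : ∀ γ η : sourceFiber x, ∃ W : Set G, IsOpen W ∧
      mul (γ : G) (inv (η : G)) (src_eq_of_mem γ η) ∈ W ∧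
      Set.InjOn (src : G → G) W ∧ Set.InjOn (rng : G → G) W ∧
      ∀ α ∈ W, src α ∈ V (rng (η : G)) ∧ rng α ∈ V (rng (γ : G)) ∧ l α < l γ + l η + 1 := by
    intro γ η
    obtain ⟨O, hO, hδ, hs, hr⟩ := hG.exists_bisection
      (mul (γ : G) (inv (η : G)) (src_eq_of_mem γ η))
    refine ⟨O ∩ (src ⁻¹' V (rng (η : G)) ∩ (rng ⁻¹' V (rng (γ : G)) ∩
      l ⁻¹' Set.Iio (l γ + l η + 1))), ?_, ⟨hδ, ?_, ?_, ?_⟩, hs.mono Set.inter_subset_left,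
      hr.mono Set.inter_subset_left, fun α hα => hα.2⟩
    · exact hO.inter (((hV _).2.preimage TopGroupoid.continuous_src).inter
        (((hV _).2.preimage TopGroupoid.continuous_rng).inter (isOpen_Iio.preimage hl)))
    · rw [Set.mem_preimage, src_mul, src_inv]
      exact (hV _).1
    · rw [Set.mem_preimage, rng_mul]
      exact (hV _).1
    · exact lt_of_le_of_lt (l.map_div_le _) (lt_add_one _)
  choose W hWo hWmem hWs hWr hWp using hW
  have hWeq : ∀ γ ∈ F, ∀ η ∈ F, ∀ γ' ∈ F, ∀ η' ∈ F, ∀ α, α ∈ W γ η → α ∈ W γ' η' →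
      γ = γ' ∧ η = η' := fun γ hγ η hη γ' hγ' η' hη' α h h' =>
    ⟨hVeq γ hγ γ' hγ' _ (hWp γ η α h).2.1 (hWp γ' η' α h').2.1,
      hVeq η hη η' hη' _ (hWp γ η α h).1 (hWp γ' η' α h').1⟩
  choose b hbS hb1 hble hbW using fun p : sourceFiber x × sourceFiber x =>
    T.exists_bump (mul (T.rho p.1) (inv (T.rho p.2)) (T.src_rho_eq p.1 p.2)) (hWo p.1 p.2)
      (by rw [T.pi_div_rho]; exact hWmem p.1 p.2)
  set f : E → ℂ := ∑ p ∈ F ×ˢ F, b p with hf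
  have hfS : f ∈ T.sigmaC := T.sum_mem_sigmaC _ hbS
  have hfb : ∀ γ ∈ F, ∀ η ∈ F, ∀ ε, T.π ε ∈ W γ η → f ε = b (γ, η) ε := by
    intro γ hγ η hη ε hε
    rw [hf, Finset.sum_apply]
    refine Finset.sum_eq_single_of_mem _ (Finset.mk_mem_product hγ hη) fun q hq hne => ?_
    by_contra hb0
    obtain ⟨h1, h2⟩ := hWeq γ hγ η hη q.1 (Finset.mem_product.1 hq).1 q.2
      (Finset.mem_product.1 hq).2 _ hε (hbW q ε hb0)
    exact hne (Prod.ext h1.symm h2.symm)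
  have hfs : ∀ ε, f ε ≠ 0 → ∃ γ ∈ F, ∃ η ∈ F, T.π ε ∈ W γ η := by
    intro ε hε
    rw [hf, Finset.sum_apply] at hε
    obtain ⟨p, hp, hp0⟩ := Finset.exists_ne_zero_of_sum_ne_zero hε
    exact ⟨p.1, (Finset.mem_product.1 hp).1, p.2, (Finset.mem_product.1 hp).2, hbW p ε hp0⟩
  have hf1 : ∀ ε, ‖f ε‖ ≤ 1 := by
    intro ε
    by_cases h0 : f ε = 0
    · simp [h0]
    · obtain ⟨γ, hγ, η, hη, hε⟩ := hfs ε h0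
      rw [hfb γ hγ η hη ε hε]
      exact hble _ _
  have hlen : ∀ γ ∈ F, ∀ η ∈ F, ∀ α ∈ W γ η, 1 + l α ≤ 2 * R + 2 := fun γ hγ η hη α hα => by
    linarith [(hWp γ η α hα).2.2, hR γ hγ, hR η hη]
  refine ⟨f, hfS, fun γ hγ η hη => ?_, fun t ht => max_le (iSup_le fun y => ?_)
    (iSup_le fun y => ?_)⟩
  · rw [hfb γ hγ η hη _ (by rw [T.pi_div_rho]; exact hWmem γ η)]
    exact hb1 (γ, η)
  -- The common source `y` already fixes `η`, and then `γ` fixes the arrow in the bisection `W γ η`.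
  -- So `|F|` labels suffice instead of `|F|²`; this gain drives the converse.
  · refine T.fiberNorm_le_of_support ht F (fun γ α => ∃ η ∈ F, α ∈ W γ η) hf1 ?_ ?_ ?_
    · intro α hα
      obtain ⟨γ, hγ, η, hη, h⟩ := hfs _ hα
      rw [T.pi_rho] at h
      exact hlen γ hγ η hη α h
    · intro α hα
      obtain ⟨γ, hγ, η, hη, h⟩ := hfs _ hα
      rw [T.pi_rho] at h
      exact ⟨γ, hγ, η, hη, h⟩
    · rintro γ hγ α hα β hβ ⟨η, hη, h⟩ ⟨η', hη', h'⟩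
      have hαβ : src α = src β := Eq.trans hα (Eq.symm hβ)
      obtain rfl : η = η' := hVeq η hη η' hη' (src α) (hWp _ _ _ h).1
        (by rw [hαβ]; exact (hWp _ _ _ h').1)
      exact hWs γ η h h' hαβ
  · have hsupp : ∀ α : G, involution f (T.rho α) ≠ 0 →
        ∃ γ ∈ F, ∃ η ∈ F, inv α ∈ W γ η := fun α hα => by
      obtain ⟨γ, hγ, η, hη, h⟩ := hfs (inv (T.rho α)) fun h0 => hα (by simp [involution, h0])
      rw [T.π.map_inv, T.pi_rho] at h
      exact ⟨γ, hγ, η, hη, h⟩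
    -- For `f*` the roles swap: the range of `α⁻¹` fixes `γ`, and `η` is the label.
    refine T.fiberNorm_le_of_support ht F (fun η α => ∃ γ ∈ F, inv α ∈ W γ η)
      (fun ε => ?_) ?_ ?_ ?_
    · rw [involution, RCLike.norm_conj]
      exact hf1 _
    · intro α hα
      obtain ⟨γ, hγ, η, hη, h⟩ := hsupp α hα
      rw [← l.map_inv]
      exact hlen γ hγ η hη _ h
    · intro α hα
      obtain ⟨γ, hγ, η, hη, h⟩ := hsupp α hα
      exact ⟨η, hη, γ, hγ, h⟩
    · rintro η hη α hα β hβ ⟨γ, hγ, h⟩ ⟨γ', hγ', h'⟩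
      have hαβ : rng (inv α) = rng (inv β) := by
        rw [rng_inv, rng_inv]
        exact Eq.trans hα (Eq.symm hβ)
      obtain rfl : γ = γ' := hVeq γ hγ γ' hγ' (rng (inv α)) (hWp _ _ _ h).2.1
        (by rw [hαβ]; exact (hWp _ _ _ h').2.1)
      exact inv_injective (hWr γ η h h' hαβ)

/-- If the matrix of `λ_x(f)` has only entries `1` on a finite set, then its norm is at least the
cardinality of the set. -/
theorem card_le_regRepNorm {f : E → ℂ} {x : units G} (F : Finset (sourceFiber x))
    (hF : F.Nonempty) (hf : ∀ γ ∈ F, ∀ η ∈ F,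
      f (mul (T.rho γ) (inv (T.rho η)) (T.src_rho_eq γ η)) = 1) :
    ENNReal.ofReal F.card ≤ T.regRepNorm f x := by
  classical
  have hn : (0 : ℝ) < F.card := by exact_mod_cast hF.card_pos
  -- The test vector is the normalised indicator of `F`: its image equals `|F| c` on `F`, with ℓ²
  -- norm `|F|` there.
  set c : ℝ := (√F.card)⁻¹ with hc
  have hc0 : 0 ≤ c := by positivity
  have hc2 : F.card * c ^ 2 = 1 := by
    rw [hc, inv_pow, Real.sq_sqrt hn.le, mul_inv_cancel₀ hn.ne']
  have hmem : Memℓp (fun η : sourceFiber x => if η ∈ F then (c : ℂ) else 0) 2 := by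
    refine memℓp_gen (summable_of_hasFiniteSupport (F.finite_toSet.subset fun η hη => ?_))
    by_contra h
    refine hη ?_
    simp [show η ∉ F from h]
  set ξ : lp (fun _ : sourceFiber x => ℂ) 2 := ⟨_, hmem⟩ with hξ
  have hξv : ∀ η, ξ η = if η ∈ F then (c : ℂ) else 0 := fun _ => rfl
  have hξn : ‖ξ‖ ≤ 1 := by
    have h := lp.norm_rpow_eq_tsum (by norm_num : 0 < (2 : ℝ≥0∞).toReal) ξ
    simp only [ENNReal.toReal_ofNat, Real.rpow_ofNat] at h
    rw [tsum_eq_sum (s := F) (fun η hη => by simp [hξv, hη]),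
      Finset.sum_congr rfl (g := fun _ => c ^ 2) (fun η hη => by
        simp [hξv, hη]), Finset.sum_const, nsmul_eq_mul, hc2] at h
    exact (sq_le_one_iff₀ (norm_nonneg ξ)).1 h.le
  have hreg : ∀ γ ∈ F, T.regRep f x ξ γ = ((F.card * c : ℝ) : ℂ) := fun γ hγ => by
    rw [regRep, tsum_eq_sum (s := F) (fun η hη => by simp [hξv, hη]),
      Finset.sum_congr rfl (g := fun _ => (c : ℂ)) (fun η hη => by
        rw [hξv, if_pos hη, hf γ hγ η hη, one_mul]), Finset.sum_const, nsmul_eq_mul]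
    push_cast
    rfl
  have hsum : ENNReal.ofReal F.card ^ 2 ≤ ∑' γ : sourceFiber x, ‖T.regRep f x ξ γ‖ₑ ^ 2 := by
    refine le_trans (le_of_eq ?_) (ENNReal.sum_le_tsum F)
    rw [Finset.sum_congr rfl (g := fun _ => ENNReal.ofReal F.card) (fun γ hγ => ?_),
      Finset.sum_const, nsmul_eq_mul, sq]
    · simp
    · rw [hreg γ hγ, ← ofReal_norm, Complex.norm_real, Real.norm_of_nonneg (by positivity),
        ← ENNReal.ofReal_pow (by positivity)]
      congr 1
      linear_combination (F.card : ℝ) * hc2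
  rw [← ENNReal.sq_sqrt (ENNReal.ofReal F.card)]
  exact (ENNReal.rpow_le_rpow hsum (by norm_num)).trans
    (le_iSup₂ (f := fun (ξ : lp (fun _ : sourceFiber x => ℂ) 2) (_ : ‖ξ‖ ≤ 1) =>
      (∑' γ : sourceFiber x, ‖T.regRep f x ξ γ‖ₑ ^ 2) ^ (1 / 2 : ℝ)) ξ hξn)

/-- Squaring `|F| ≤ C (|F| (2R + 2) ^ (2t)) ^ (1/2)` leaves one factor `|F|` to cancel. -/
theorem card_le_of_trivial_isotropy (hG : IsEtaleGroupoid G) {l : LengthFunction G}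
    (hl : Continuous l) {C t : ℝ} (hC : 0 ≤ C) (ht : 0 ≤ t)
    (hRD : ∀ f ∈ T.sigmaC, T.reducedNorm f ≤ ENNReal.ofReal C * T.decayNorm l t f)
    {x : units G} (hx : {a : G | src a = x ∧ rng a = x} = {(x : G)})
    (F : Finset (sourceFiber x)) {R : ℝ} (hR0 : 0 ≤ R) (hR : ∀ γ ∈ F, l γ ≤ R) :
    (F.card : ℝ) ≤ C ^ 2 * (2 * R + 2) ^ (2 * t) := by
  rcases F.eq_empty_or_nonempty with rfl | hF
  · simp only [Finset.card_empty, Nat.cast_zero]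
    positivity
  have hn : (0 : ℝ) < F.card := by exact_mod_cast hF.card_pos
  obtain ⟨f, hfS, hf1, hft⟩ := T.exists_test_function hG hl hx F hR
  set D : ℝ := (2 * R + 2) ^ (2 * t) with hD
  have hD0 : 0 ≤ D := by positivity
  have h1 : ENNReal.ofReal F.card ≤ ENNReal.ofReal C *
      ENNReal.ofReal (F.card * D) ^ (1 / 2 : ℝ) :=
    (T.card_le_regRepNorm F hF hf1).trans ((le_iSup (T.regRepNorm f) x).trans
      ((hRD f hfS).trans (by gcongr; exact hft t ht)))
  rw [ENNReal.ofReal_rpow_of_nonneg (by positivity) (by norm_num), ← ENNReal.ofReal_mul hC,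
    ENNReal.ofReal_le_ofReal_iff (by positivity), ← Real.sqrt_eq_rpow] at h1
  have h2 : (F.card : ℝ) ^ 2 ≤ C ^ 2 * (F.card * D) := by
    calc (F.card : ℝ) ^ 2 ≤ (C * √(F.card * D)) ^ 2 := by gcongr
      _ = _ := by rw [mul_pow, Real.sq_sqrt (by positivity)]
  refine le_of_mul_le_mul_left ?_ hn
  linarith

end Twist

/-! ### From a dense set of units to all units. -/

/-- Finite subsets of a ball can be moved to the fibres over nearby units. -/
theorem exists_finset_of_dense {G : Type u} [TopologicalSpace G] [TopGroupoid G]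
    (hG : IsEtaleGroupoid G) {l : LengthFunction G} (hl : Continuous l) {P : Set (units G)}
    (hP : Dense P) {x : units G} (F : Finset G) {R : ℝ} (hF : ∀ γ ∈ F, src γ = x ∧ l γ < R) :
    ∃ y ∈ P, ∃ F' : Finset (sourceFiber y), F'.card = F.card ∧ ∀ γ ∈ F', l γ ≤ R := by
  classical
  obtain ⟨O, hO, hOd⟩ := F.finite_toSet.t2_separation
  -- The sets `A γ` are open and disjoint, and the source map is open, so every unit near `x` lifts
  -- to one arrow in each, and these lifts are distinct.
  set A : G → Set G := fun γ => O γ ∩ l ⁻¹' Set.Iio R with hA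
  have hopen : IsOpen (⋂ γ ∈ F, srcU '' A γ : Set (units G)) :=
    isOpen_biInter_finset fun γ _ =>
      hG.isOpenMap _ ((hO γ).2.inter (isOpen_Iio.preimage hl))
  have hxm : x ∈ (⋂ γ ∈ F, srcU '' A γ : Set (units G)) :=
    Set.mem_iInter₂.2 fun γ hγ => ⟨γ, ⟨(hO γ).1, (hF γ hγ).2⟩, Subtype.ext (hF γ hγ).1⟩
  obtain ⟨y, hy, hyP⟩ := hP.inter_open_nonempty _ hopen ⟨x, hxm⟩
  choose φ hφA hφy using fun γ : F => Set.mem_iInter₂.1 hy γ γ.2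
  have hφinj : Function.Injective φ := fun γ η h => by
    by_contra hne
    exact Set.disjoint_left.1 (hOd γ.2 η.2 (fun e => hne (Subtype.ext e))) (hφA γ).1
      (by rw [h]; exact (hφA η).1)
  set ψ : F → sourceFiber y := fun γ => ⟨φ γ, congrArg Subtype.val (hφy γ)⟩ with hψ
  have hψinj : Function.Injective ψ := fun γ η h => hφinj (congrArg Subtype.val h)
  refine ⟨y, hyP, Finset.univ.image ψ, ?_, fun γ hγ => ?_⟩
  · rw [Finset.card_image_of_injective _ hψinj, Finset.card_univ, Fintype.card_coe]
  · obtain ⟨η, -, rfl⟩ := Finset.mem_image.1 hγ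
    exact le_of_lt (hφA η).2

/-- An infinite set would contain a finite subset with `⌊B⌋₊ + 1 > B` elements. -/
theorem Set.finite_and_ncard_le_of_forall_finset {α : Type*} {s : Set α} {B : ℝ}
    (h : ∀ F : Finset α, (F : Set α) ⊆ s → (F.card : ℝ) ≤ B) : s.Finite ∧ (s.ncard : ℝ) ≤ B := by
  have hfin : s.Finite := by
    by_contra hinf
    obtain ⟨F, hF, hcard⟩ := Set.Infinite.exists_subset_card_eq hinf (⌊B⌋₊ + 1)
    have := h F hF
    rw [hcard] at this
    push_cast at this
    linarith [Nat.lt_floor_add_one B]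
  refine ⟨hfin, ?_⟩
  have := h hfin.toFinset (by simp)
  rwa [← Set.ncard_eq_toFinset_card s hfin] at this

theorem Twist.HasRapidDecay.hasPolynomialGrowth {G : Type u} {E : Type v} [TopologicalSpace G]
    [TopGroupoid G] [TopologicalSpace E] [TopGroupoid E] {T : Twist G E}
    (hG : IsEtaleGroupoid G) (hP : IsTopologicallyPrincipal G) {l : LengthFunction G}
    (hl : Continuous l) (h : T.HasRapidDecay l) : l.HasPolynomialGrowth := by
  obtain ⟨C, hC, t, ht, hRD⟩ := h
  -- The `4` comes from `2(R + 1) + 2 ≤ 4(1 + R)`. Each `+ 1` secures strict positivity, as `C` and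
  -- `t` may vanish.
  refine ⟨C ^ 2 * 4 ^ (2 * t) + 1, by positivity, 2 * t + 1, by positivity, fun x hx R hR => ?_⟩
  refine Set.finite_and_ncard_le_of_forall_finset fun F hF => ?_
  -- Enlarging the radius to `R + 1` turns `l γ ≤ R` into the strict inequality that survives moving
  -- to a nearby fibre.
  obtain ⟨y, hy, F', hcard, hF'⟩ := exists_finset_of_dense hG hl hP (x := ⟨x, hx⟩) F (R := R + 1)
    fun γ hγ => by
      obtain ⟨h1, h2⟩ := (l.mem_ball_unit hx).1 (hF hγ)
      exact ⟨h1, by linarith⟩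
  have hb := T.card_le_of_trivial_isotropy hG hl hC ht hRD hy F' (by linarith) hF'
  rw [hcard] at hb
  refine hb.trans ?_
  have h1 : (2 * (R + 1) + 2) ^ (2 * t) ≤ 4 ^ (2 * t) * (1 + R) ^ (2 * t) := by
    rw [← Real.mul_rpow (by norm_num) (by positivity)]
    exact Real.rpow_le_rpow (by positivity) (by linarith) (by positivity)
  have h2 : (1 + R) ^ (2 * t) ≤ (1 + R) ^ (2 * t + 1) :=
    Real.rpow_le_rpow_of_exponent_le (by linarith) (by linarith)
  calc C ^ 2 * (2 * (R + 1) + 2) ^ (2 * t)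
      ≤ C ^ 2 * (4 ^ (2 * t) * (1 + R) ^ (2 * t + 1)) := by
        gcongr
        exact h1.trans (by gcongr)
    _ = C ^ 2 * 4 ^ (2 * t) * (1 + R) ^ (2 * t + 1) := by ring
    _ ≤ (C ^ 2 * 4 ^ (2 * t) + 1) * (1 + R) ^ (2 * t + 1) := by
        gcongr
        linarith

theorem theorem3p3 {G : Type u} [TopologicalSpace G] [TopGroupoid G] [SigmaCompactSpace G]
    (hG : IsEtaleGroupoid G) (hP : IsTopologicallyPrincipal G)
    (l : LengthFunction G) (hl : Continuous l) (hl' : l.IsProper) :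
    List.TFAE [
      l.HasPolynomialGrowth,
      ∀ (E : Type u) [TopologicalSpace E] [TopGroupoid E] (T : Twist G E), T.HasRapidDecay l,
      ∃ (E : Type u) (_ : TopologicalSpace E) (_ : TopGroupoid E) (T : Twist G E),
        T.HasRapidDecay l] := by
  tfae_have 1 → 2 := fun h E _ _ T => T.hasRapidDecay_of_hasPolynomialGrowth h
  tfae_have 2 → 3 := fun h => ⟨G × Circle, inferInstance, inferInstance, trivialTwist G, h _ _⟩
  tfae_have 3 → 1 := fun ⟨_, _, _, _, h⟩ => h.hasPolynomialGrowth hG hP hl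
  tfae_finish
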